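/- Let $n\in\mathbb{N}$ and let $J=\begin{pmatrix}0&\mathbb{1}_n\\-\mathbb{1}_n&0\end{pmatrix}$. Let $Sp(2n)=\{S\in\mathbb{R}^{2n\times 2n}\mid S^TJS=J\}$ be the real symplectic group, and for $A\in\mathbb{R}^{2n\times 2n}$ with singular values $s_1(A)\ge s_2(A)\ge\dots\ge s_{2n}(A)$ put $F(A)=\sum_{i=1}^n\log s_i(A)$ (the sum over the $n$ largest singular values). For $\Gamma\in\mathbb{R}^{2n\times 2n}$ define the squeezing measure $$G(\Gamma)=\inf\{F(S)\mid S\in Sp(2n),\ \Gamma\ge S^TS\},$$ where $\ge$ is the positive semidefinite order on Hermitian matrices. Then on the set of covariance matrices $$\{\Gamma\in\mathbb{R}^{2n\times 2n}\mid \Gamma\ge iJ\}$$ (real matrices $\Gamma$ such that $\Gamma-iJ$ is Hermitian and positive semidefinite) the infimum defining $G$ is finite, i.e. it is the infimum of a nonempty set of reals that is bounded below, and $G$ is convex: the set is convex, and for all $\Gamma,\Gamma'$ in it and all $t\in[0,1]$, $$G(t\Gamma+(1-t)\Gamma')\le t\,G(\Gamma)+(1-t)\,G(\Gamma').$$ 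-/

import Mathlib

/-!
Every positive definite symplectic matrix is a Cayley transform `(1 + K) / (1 - K)` of a symmetric
strict contraction `K` with `Jᵀ K J = -K`, and such `K` form a convex set. Since
`(1 + K) / (1 - K) = 2 (1 - K)⁻¹ - 1` is operator convex in `K`, averaging the `K` of two
competitors for `Γ` and `Γ'` gives a competitor for the average of `Γ` and `Γ'`.

The eigenvalues of `Sᵀ S` come in pairs `λ, λ⁻¹`, so `F S = 4⁻¹ tr |log (Sᵀ S)|`. In terms of `K`
this is a multiple of the trace of `|log ((1 + u) / (1 - u))| = log (1 + |u|) - log (1 - |u|)`,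
which is convex in `u`; hence the cost of the averaged competitor is at most the average cost.

A competitor exists because `Γ ≥ iJ` means `Jᵀ Γ⁻¹ J ≤ Γ` (a Schur complement), so that the
geometric mean of `Γ` and `Jᵀ Γ⁻¹ J` is at most `Γ`, and it is symplectic.
-/

open Matrix
open scoped ComplexOrder

namespace Squeezing

noncomputable section

/-- Real `2n × 2n` matrices, in the basis `(Q₁, …, Qₙ, P₁, …, Pₙ)`. -/
abbrev Mat (n : ℕ) : Type := Matrix (Fin n ⊕ Fin n) (Fin n ⊕ Fin n) ℝ

/-- The symplectic form `J = (0, 1; -1, 0)`. (Mathlib's `Matrix.J` is its negative.) -/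
def symplecticForm (n : ℕ) : Mat n := Matrix.fromBlocks 0 1 (-1) 0

/-- Mathlib's symplectic group is `Sp(2n) = {S | Sᵀ J S = J}` for this `J`. -/
theorem mem_symplecticGroup_iff {n : ℕ} (S : Mat n) :
    S ∈ Matrix.symplecticGroup (Fin n) ℝ ↔ Sᵀ * symplecticForm n * S = symplecticForm n := by
  have h : symplecticForm n = -Matrix.J (Fin n) ℝ := by
    simp [symplecticForm, Matrix.J, Matrix.fromBlocks_neg]
  rw [SymplecticGroup.mem_iff', h, Matrix.mul_neg, Matrix.neg_mul, neg_inj]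

/-- The covariance matrices: the real matrices `Γ` with `Γ ≥ iJ`, that is, such that the complex
matrix `Γ - iJ` is (Hermitian and) positive semidefinite. -/
def covarianceMatrices (n : ℕ) : Set (Mat n) :=
  {Γ | (Γ.map Complex.ofReal - Complex.I • (symplecticForm n).map Complex.ofReal).PosSemidef}

/-- `F(A) = ∑_{i=1}^n log sᵢ(A)`, where `s₁(A) ≥ … ≥ s₂ₙ(A)` are the singular values of the
`2n × 2n` matrix `A`: the sum runs over the `n` largest ones.
(`LinearMap.singularValues` is decreasing and indexed from `0`.) -/
def F {n : ℕ} (A : Mat n) : ℝ :=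
  ∑ i ∈ Finset.range n, Real.log ((Matrix.toEuclideanLin A).singularValues i)

/-- The set `{F(S) | Γ ≥ SᵀS, S ∈ Sp(2n)}`. -/
def costs {n : ℕ} (Γ : Mat n) : Set ℝ :=
  {x | ∃ S ∈ Matrix.symplecticGroup (Fin n) ℝ, (Γ - Sᵀ * S).PosSemidef ∧ F S = x}

/-- The squeezing measure `G(Γ) = inf {F(S) | Γ ≥ SᵀS, S ∈ Sp(2n)}`. -/
def G {n : ℕ} (Γ : Mat n) : ℝ := sInf (costs Γ)

end

end Squeezing

namespace Squeezing

open scoped MatrixOrder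

section Cayley

/-- The Cayley transform, an increasing bijection from `(-1, 1)` onto `(0, ∞)` which turns
negation into inversion. -/
noncomputable def cayley (u : ℝ) : ℝ := (1 + u) / (1 - u)

theorem cayley_neg (u : ℝ) : cayley (-u) = (cayley u)⁻¹ := by
  simp [cayley, sub_eq_add_neg]

theorem cayley_pos {u : ℝ} (hu : u ∈ Set.Ioo (-1) 1) : 0 < cayley u :=
  div_pos (by linarith [hu.1]) (by linarith [hu.2])

theorem cayley_eq_two_mul_inv_sub_one {u : ℝ} (hu : u ≠ 1) : cayley u = 2 * (1 - u)⁻¹ - 1 := by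
  have : 1 - u ≠ 0 := sub_ne_zero.mpr hu.symm
  unfold cayley
  field_simp
  ring

theorem abs_log_cayley {u : ℝ} (hu : u ∈ Set.Ioo (-1) 1) :
    |Real.log (cayley u)| = Real.log (1 + |u|) - Real.log (1 - |u|) := by
  have hlog {v : ℝ} (hv : v ∈ Set.Ico 0 1) :
      |Real.log (cayley v)| = Real.log (1 + v) - Real.log (1 - v) := by
    rw [abs_of_nonneg (Real.log_nonneg ?_), cayley, Real.log_div]
    · linarith [hv.1]
    · linarith [hv.2]
    · rw [cayley, one_le_div] <;> linarith [hv.1, hv.2]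
  rcases le_total 0 u with h | h
  · rw [abs_of_nonneg h, hlog ⟨h, hu.2⟩]
  · rw [abs_of_nonpos h, ← hlog ⟨neg_nonneg.mpr h, by linarith [hu.1]⟩, cayley_neg, Real.log_inv,
      abs_neg]

theorem convexOn_abs_log_cayley :
    ConvexOn ℝ (Set.Ioo (-1) 1) fun u => |Real.log (cayley u)| := by
  refine ⟨convex_Ioo _ _, fun x hx y hy a b ha hb hab => ?_⟩
  have hseries {u : ℝ} (hu : u ∈ Set.Ioo (-1 : ℝ) 1) :
      HasSum (fun k : ℕ => 2 * (1 / (2 * k + 1)) * |u| ^ (2 * k + 1))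
        |Real.log (cayley u)| := by
    rw [abs_log_cayley hu]
    exact Real.hasSum_log_sub_log_of_abs_lt_one (by rwa [abs_abs, abs_lt])
  have hpow (k : ℕ) : ConvexOn ℝ Set.univ fun u : ℝ => |u| ^ k :=
    (convexOn_univ_norm (E := ℝ)).pow (fun _ _ => abs_nonneg _) k
  refine hasSum_le (fun k => ?_) (hseries (convex_Ioo _ _ hx hy ha hb hab))
    (((hseries hx).mul_left a).add ((hseries hy).mul_left b))
  have hk := ((hpow (2 * k + 1)).smul (show (0 : ℝ) ≤ 2 * (1 / (2 * k + 1)) by positivity)).2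
    (Set.mem_univ x) (Set.mem_univ y) ha hb hab
  simpa only [smul_eq_mul] using hk

end Cayley

section TraceConvexity

variable {𝕜 m : Type*} [RCLike 𝕜] [Fintype m] [DecidableEq m]

theorem sum_norm_sq_row_eq_one (U : unitaryGroup m 𝕜) (i : m) :
    ∑ j, ‖(U : Matrix m m 𝕜) i j‖ ^ 2 = 1 := by
  have h : ((U : Matrix m m 𝕜) * star (U : Matrix m m 𝕜)) i i = 1 := by simp
  simp only [mul_apply, star_apply, RCLike.star_def, RCLike.mul_conj] at h
  exact_mod_cast h

theorem re_cfc_apply_self {A : Matrix m m 𝕜} (hA : A.IsHermitian) (f : ℝ → ℝ) (i : m) :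
    RCLike.re (cfc f A i i) =
      ∑ j, ‖(hA.eigenvectorUnitary : Matrix m m 𝕜) i j‖ ^ 2 * f (hA.eigenvalues j) := by
  have hterm (z : 𝕜) (r : ℝ) : RCLike.re (z * r * star z) = ‖z‖ ^ 2 * r := by
    rw [mul_right_comm, RCLike.star_def, RCLike.mul_conj]
    norm_cast
  rw [hA.cfc_eq, IsHermitian.cfc, Unitary.conjStarAlgAut_apply, mul_apply, map_sum]
  refine Finset.sum_congr rfl fun j _ => ?_
  rw [mul_diagonal, star_apply]
  exact hterm _ _

theorem re_apply_self {A : Matrix m m 𝕜} (hA : A.IsHermitian) (i : m) :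
    RCLike.re (A i i) =
      ∑ j, ‖(hA.eigenvectorUnitary : Matrix m m 𝕜) i j‖ ^ 2 * hA.eigenvalues j := by
  simpa only [cfc_id ℝ A hA.isSelfAdjoint, id_eq] using re_cfc_apply_self hA id i

/-- The Hermitian matrices all of whose eigenvalues lie in `s`. -/
def hermitianWithSpectrum (𝕜 m : Type*) [RCLike 𝕜] [Fintype m] [DecidableEq m] (s : Set ℝ) :
    Set (Matrix m m 𝕜) :=
  {A | A.IsHermitian ∧ spectrum ℝ A ⊆ s}

variable {s : Set ℝ} {A : Matrix m m 𝕜}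

theorem re_apply_self_mem (hs : Convex ℝ s) (hA : A ∈ hermitianWithSpectrum 𝕜 m s) (i : m) :
    RCLike.re (A i i) ∈ s := by
  rw [re_apply_self hA.1]
  exact hs.sum_mem (fun _ _ => sq_nonneg _) (sum_norm_sq_row_eq_one _ i)
    fun j _ => hA.2 (hA.1.eigenvalues_mem_spectrum_real j)

theorem convexOn_re_apply_self_le {φ : ℝ → ℝ} (hφ : ConvexOn ℝ s φ)
    (hA : A ∈ hermitianWithSpectrum 𝕜 m s) (i : m) :
    φ (RCLike.re (A i i)) ≤ RCLike.re (cfc φ A i i) := by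
  rw [re_apply_self hA.1, re_cfc_apply_self hA.1]
  exact hφ.map_sum_le (fun _ _ => sq_nonneg _) (sum_norm_sq_row_eq_one _ i)
    fun j _ => hA.2 (hA.1.eigenvalues_mem_spectrum_real j)

theorem trace_cfc_eq_sum_eigenvalues (hA : A.IsHermitian) (f : ℝ → ℝ) :
    trace (cfc f A) = ∑ i, (f (hA.eigenvalues i) : 𝕜) := by
  rw [hA.cfc_eq, IsHermitian.cfc, Unitary.conjStarAlgAut_apply, trace_mul_cycle]
  simp [trace_diagonal]

theorem conj_mem_hermitianWithSpectrum (U : unitaryGroup m 𝕜)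
    (hA : A ∈ hermitianWithSpectrum 𝕜 m s) :
    star (U : Matrix m m 𝕜) * A * U ∈ hermitianWithSpectrum 𝕜 m s :=
  ⟨isHermitian_conjTranspose_mul_mul _ hA.1, by
    rw [Unitary.spectrum_star_left_conjugate]; exact hA.2⟩

theorem cfc_conj (U : unitaryGroup m 𝕜) (hA : A.IsHermitian) (f : ℝ → ℝ) :
    cfc f (star (U : Matrix m m 𝕜) * A * U) = star (U : Matrix m m 𝕜) * cfc f A * U := by
  have hcont : Continuous fun X : Matrix m m 𝕜 => Unitary.conjStarAlgAut ℝ _ (star U) X := by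
    simp only [Unitary.conjStarAlgAut_apply]
    fun_prop
  have h := StarAlgHomClass.map_cfc (Unitary.conjStarAlgAut ℝ (Matrix m m 𝕜) (star U)) f A
    (A.finite_real_spectrum.continuousOn f) hcont hA
    (by simpa using hA.isSelfAdjoint.conjugate' (U : Matrix m m 𝕜))
  rw [Unitary.conjStarAlgAut_star_apply, Unitary.conjStarAlgAut_star_apply] at h
  exact h.symm

theorem eigenvalues_eq_re_conj (hA : A.IsHermitian) (i : m) :
    hA.eigenvalues i =
      RCLike.re
        ((star (hA.eigenvectorUnitary : Matrix m m 𝕜) * A * hA.eigenvectorUnitary) i i) := by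
  have h := hA.conjStarAlgAut_star_eigenvectorUnitary
  rw [Unitary.conjStarAlgAut_star_apply] at h
  simp [h]

theorem convex_hermitianWithSpectrum (hs : Convex ℝ s) :
    Convex ℝ (hermitianWithSpectrum 𝕜 m s) := by
  intro A hA B hB a b ha hb hab
  have hC : (a • A + b • B).IsHermitian :=
    (IsSelfAdjoint.smul (.all a) hA.1).add (IsSelfAdjoint.smul (.all b) hB.1)
  refine ⟨hC, ?_⟩
  rw [hC.spectrum_real_eq_range_eigenvalues]
  rintro _ ⟨i, rfl⟩
  rw [eigenvalues_eq_re_conj]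
  simpa [mul_add, add_mul, RCLike.smul_re] using
    hs (re_apply_self_mem hs (conj_mem_hermitianWithSpectrum hC.eigenvectorUnitary hA) i)
      (re_apply_self_mem hs (conj_mem_hermitianWithSpectrum hC.eigenvectorUnitary hB) i) ha hb hab

theorem sum_re_conj_apply_self_le_re_trace_cfc {φ : ℝ → ℝ} (hφ : ConvexOn ℝ s φ)
    (U : unitaryGroup m 𝕜) (hA : A ∈ hermitianWithSpectrum 𝕜 m s) :
    ∑ i, φ (RCLike.re ((star (U : Matrix m m 𝕜) * A * U) i i)) ≤ RCLike.re (trace (cfc φ A)) :=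
  calc ∑ i, φ (RCLike.re ((star (U : Matrix m m 𝕜) * A * U) i i))
    _ ≤ ∑ i, RCLike.re (cfc φ (star (U : Matrix m m 𝕜) * A * U) i i) :=
        Finset.sum_le_sum fun i _ =>
          convexOn_re_apply_self_le hφ (conj_mem_hermitianWithSpectrum U hA) i
    _ = RCLike.re (trace (cfc φ A)) := by
        rw [← map_sum, cfc_conj U hA.1]
        change RCLike.re (trace _) = _
        rw [trace_mul_cycle, Unitary.mul_star_self_of_mem U.2, one_mul]

theorem convexOn_re_trace_cfc {φ : ℝ → ℝ} (hφ : ConvexOn ℝ s φ) :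
    ConvexOn ℝ (hermitianWithSpectrum 𝕜 m s) fun A => RCLike.re (trace (cfc φ A)) := by
  have hconv := convex_hermitianWithSpectrum (𝕜 := 𝕜) (m := m) hφ.1
  refine ⟨hconv, fun A hA B hB a b ha hb hab => ?_⟩
  have hC := (hconv hA hB ha hb hab).1
  set U := hC.eigenvectorUnitary with hU
  calc RCLike.re (trace (cfc φ (a • A + b • B)))
    _ = ∑ i, φ (a • RCLike.re ((star (U : Matrix m m 𝕜) * A * U) i i)
          + b • RCLike.re ((star (U : Matrix m m 𝕜) * B * U) i i)) := by
        rw [trace_cfc_eq_sum_eigenvalues hC, map_sum]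
        refine Finset.sum_congr rfl fun i _ => ?_
        rw [RCLike.ofReal_re, eigenvalues_eq_re_conj]
        simp [mul_add, add_mul, RCLike.smul_re, ← hU]
    _ ≤ ∑ i, (a • φ (RCLike.re ((star (U : Matrix m m 𝕜) * A * U) i i))
          + b • φ (RCLike.re ((star (U : Matrix m m 𝕜) * B * U) i i))) :=
        Finset.sum_le_sum fun i _ => hφ.2
          (re_apply_self_mem hφ.1 (conj_mem_hermitianWithSpectrum U hA) i)
          (re_apply_self_mem hφ.1 (conj_mem_hermitianWithSpectrum U hB) i) ha hb hab
    _ ≤ a • RCLike.re (trace (cfc φ A)) + b • RCLike.re (trace (cfc φ B)) := by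
        rw [Finset.sum_add_distrib, ← Finset.smul_sum, ← Finset.smul_sum]
        gcongr
        exacts [sum_re_conj_apply_self_le_re_trace_cfc hφ U hA,
          sum_re_conj_apply_self_le_re_trace_cfc hφ U hB]

end TraceConvexity

section CayleyTransform

variable {𝕜 m : Type*} [RCLike 𝕜] [Fintype m] [DecidableEq m] {A : Matrix m m 𝕜} {s t : Set ℝ}

theorem cfc_cfc (hA : A.IsHermitian) (g f : ℝ → ℝ) :
    cfc g (cfc f A) = cfc (fun x => g (f x)) A :=
  (cfc_comp' g f A ((A.finite_real_spectrum.image f).continuousOn g)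
    (A.finite_real_spectrum.continuousOn f) hA).symm

theorem cfc_mem_hermitianWithSpectrum {f : ℝ → ℝ} (hf : Set.MapsTo f s t)
    (hA : A ∈ hermitianWithSpectrum 𝕜 m s) : cfc f A ∈ hermitianWithSpectrum 𝕜 m t := by
  refine ⟨cfc_predicate f A, ?_⟩
  rw [cfc_map_spectrum f A hA.1.isSelfAdjoint (A.finite_real_spectrum.continuousOn f)]
  exact (hf.mono_left hA.2).image_subset

theorem posDef_iff_mem_hermitianWithSpectrum :
    A.PosDef ↔ A ∈ hermitianWithSpectrum 𝕜 m (Set.Ioi 0) := by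
  rw [← isStrictlyPositive_iff_posDef]
  exact ⟨fun h => ⟨h.isSelfAdjoint, (StarOrderedRing.isStrictlyPositive_iff_spectrum_pos A).mp h⟩,
    fun h => (StarOrderedRing.isStrictlyPositive_iff_spectrum_pos A h.1).mpr h.2⟩

theorem cfc_inv_eq_inv (hA : A.PosDef) : cfc (fun x : ℝ => x⁻¹) A = A⁻¹ := by
  rw [cfc_ringInverse_id A hA.isUnit hA.1.isSelfAdjoint, nonsing_inv_eq_ringInverse]

theorem convexOn_inv : ConvexOn ℝ {A : Matrix m m 𝕜 | A.PosDef} (·⁻¹) := by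
  have hconv : Convex ℝ {A : Matrix m m 𝕜 | A.PosDef} := by
    simp only [posDef_iff_mem_hermitianWithSpectrum]
    exact convex_hermitianWithSpectrum (convex_Ioi 0)
  have hblock {X : Matrix m m 𝕜} (hX : X.PosDef) : (fromBlocks X 1 1ᴴ X⁻¹).PosSemidef := by
    have := hX.isUnit.invertible
    rw [hX.fromBlocks₁₁]
    simpa using PosSemidef.zero
  refine ⟨hconv, fun A hA B hB a b ha hb hab => ?_⟩
  have hC := hconv hA hB ha hb hab
  have := hC.isUnit.invertible
  rw [← sub_add_cancel (_ + _) (a • A + b • B)⁻¹]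
  have hsum : (fromBlocks (a • A + b • B) 1 1ᴴ (a • A⁻¹ + b • B⁻¹)).PosSemidef := by
    have h := ((hblock hA).smul ha).add ((hblock hB).smul hb)
    simpa [fromBlocks_smul, fromBlocks_add, ← add_smul, hab] using h
  simpa [le_iff] using (hC.fromBlocks₁₁ _ _).mp hsum

theorem cfc_one_sub (hA : A.IsHermitian) : cfc (fun u : ℝ => 1 - u) A = 1 - A := by
  rw [cfc_sub (fun _ => 1) (fun u => u) A, cfc_const_one ℝ A, cfc_id' ℝ A hA.isSelfAdjoint]

theorem posDef_one_sub (hA : A ∈ hermitianWithSpectrum 𝕜 m (Set.Iio 1)) : (1 - A).PosDef := by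
  rw [← cfc_one_sub hA.1, posDef_iff_mem_hermitianWithSpectrum]
  exact cfc_mem_hermitianWithSpectrum (fun u (hu : u < 1) => sub_pos.mpr hu) hA

theorem cfc_cayley_eq_two_smul_inv_sub_one (hA : A ∈ hermitianWithSpectrum 𝕜 m (Set.Iio 1)) :
    cfc cayley A = (2 : ℝ) • (1 - A)⁻¹ - 1 := by
  have hcont (f : ℝ → ℝ) : ContinuousOn f (spectrum ℝ A) := A.finite_real_spectrum.continuousOn f
  rw [cfc_congr fun u hu => cayley_eq_two_mul_inv_sub_one (hA.2 hu).ne,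
    cfc_sub (fun u => 2 * (1 - u)⁻¹) (fun _ => 1) A (hcont _) (hcont _),
    cfc_const_one ℝ A hA.1.isSelfAdjoint,
    cfc_const_mul 2 (fun u => (1 - u)⁻¹) A (hcont _), ← cfc_inv_eq_inv (posDef_one_sub hA),
    ← cfc_one_sub hA.1, cfc_cfc hA.1]

theorem convexOn_cfc_cayley :
    ConvexOn ℝ (hermitianWithSpectrum 𝕜 m (Set.Iio 1)) (cfc cayley) := by
  have hconv := convex_hermitianWithSpectrum (𝕜 := 𝕜) (m := m) (convex_Iio 1)
  refine ⟨hconv, fun A hA B hB a b ha hb hab => ?_⟩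
  have hinv := convexOn_inv.2 (posDef_one_sub hA) (posDef_one_sub hB) ha hb hab
  have hone : a • (1 - A) + b • (1 - B) = 1 - (a • A + b • B) := by
    rw [smul_sub, smul_sub, sub_add_sub_comm, ← add_smul, hab, one_smul]
  rw [cfc_cayley_eq_two_smul_inv_sub_one (hconv hA hB ha hb hab),
    cfc_cayley_eq_two_smul_inv_sub_one hA, cfc_cayley_eq_two_smul_inv_sub_one hB]
  rw [hone] at hinv
  calc (2 : ℝ) • (1 - (a • A + b • B))⁻¹ - 1
    _ ≤ (2 : ℝ) • (a • (1 - A)⁻¹ + b • (1 - B)⁻¹) - (a + b) • (1 : Matrix m m 𝕜) := by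
      rw [hab, one_smul]
      gcongr
    _ = _ := by module

end CayleyTransform

section SymplecticGroup

variable {l R : Type*} [Fintype l] [DecidableEq l] [CommRing R]

theorem mem_symplecticGroup_iff_of_isSymm {A : Matrix (l ⊕ l) (l ⊕ l) R} (hA : A.IsSymm)
    (hdet : IsUnit A.det) : A ∈ symplecticGroup l R ↔ (J l R)ᵀ * A * J l R = A⁻¹ := by
  have hJ : (J l R)ᵀ * J l R = 1 := by rw [J_transpose, neg_mul, J_squared, neg_neg]
  have hJ' : J l R * (J l R)ᵀ = 1 := by rw [J_transpose, mul_neg, J_squared, neg_neg]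
  rw [SymplecticGroup.mem_iff, hA.eq]
  constructor
  · intro h
    exact (inv_eq_left_inv (by rw [mul_assoc, mul_assoc, ← mul_assoc A, h, hJ])).symm
  · intro h
    calc A * J l R * A = J l R * ((J l R)ᵀ * A * J l R) * A := by
          simp only [← mul_assoc, hJ', one_mul]
      _ = J l R := by rw [h, mul_assoc, nonsing_inv_mul A hdet, mul_one]

variable (l) in
/-- The matrices whose Cayley transforms are the positive definite symplectic matrices: the
symmetric strict contractions that anticommute with `J`. -/
def cayleyDomain : Set (Matrix (l ⊕ l) (l ⊕ l) ℝ) :=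
  {K ∈ hermitianWithSpectrum ℝ (l ⊕ l) (Set.Ioo (-1) 1) | (J l ℝ)ᵀ * K * J l ℝ = -K}

variable (l) in
/-- The positive definite symplectic matrices. -/
def posDefSymplectic : Set (Matrix (l ⊕ l) (l ⊕ l) ℝ) :=
  {P | P.PosDef ∧ P ∈ symplecticGroup l ℝ}

theorem convex_cayleyDomain : Convex ℝ (cayleyDomain l) := by
  intro K hK L hL a b ha hb hab
  refine ⟨convex_hermitianWithSpectrum (convex_Ioo _ _) hK.1 hL.1 ha hb hab, ?_⟩
  rw [mul_add, add_mul, mul_smul_comm, mul_smul_comm, smul_mul_assoc, smul_mul_assoc, hK.2, hL.2,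
    smul_neg, smul_neg, neg_add]

theorem cfc_conj_J {A : Matrix (l ⊕ l) (l ⊕ l) ℝ} (hA : A.IsHermitian) (f : ℝ → ℝ) :
    cfc f ((J l ℝ)ᵀ * A * J l ℝ) = (J l ℝ)ᵀ * cfc f A * J l ℝ := by
  have hJ : J l ℝ ∈ unitaryGroup (l ⊕ l) ℝ := by
    rw [mem_unitaryGroup_iff, star_eq_conjTranspose, conjTranspose_eq_transpose_of_trivial,
      J_transpose, mul_neg, J_squared, neg_neg]
  exact cfc_conj ⟨J l ℝ, hJ⟩ hA f

theorem mem_posDefSymplectic_iff {P : Matrix (l ⊕ l) (l ⊕ l) ℝ} (hP : P.PosDef) :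
    P ∈ posDefSymplectic l ↔ (J l ℝ)ᵀ * P * J l ℝ = P⁻¹ := by
  rw [← mem_symplecticGroup_iff_of_isSymm (isHermitian_iff_isSymm.mp hP.1)
    ((isUnit_iff_isUnit_det P).mp hP.isUnit)]
  exact and_iff_right hP

theorem cfc_cayley_mem {K : Matrix (l ⊕ l) (l ⊕ l) ℝ} (hK : K ∈ cayleyDomain l) :
    cfc cayley K ∈ posDefSymplectic l := by
  have hpos : (cfc cayley K).PosDef := posDef_iff_mem_hermitianWithSpectrum.mpr
    (cfc_mem_hermitianWithSpectrum (fun _ => cayley_pos) hK.1)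
  rw [mem_posDefSymplectic_iff hpos]
  calc (J l ℝ)ᵀ * cfc cayley K * J l ℝ
    _ = cfc cayley (-K) := by rw [← cfc_conj_J hK.1.1, hK.2]
    _ = cfc (fun u => (cayley u)⁻¹) K := by
        rw [← cfc_comp_neg cayley K ((K.finite_real_spectrum.image _).continuousOn _)
          hK.1.1.isSelfAdjoint]
        simp only [cayley_neg]
    _ = (cfc cayley K)⁻¹ := by rw [← cfc_inv_eq_inv hpos, cfc_cfc hK.1.1]

theorem exists_cfc_cayley_eq {P : Matrix (l ⊕ l) (l ⊕ l) ℝ} (hP : P ∈ posDefSymplectic l) :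
    ∃ K ∈ cayleyDomain l, cfc cayley K = P := by
  have hP' := posDef_iff_mem_hermitianWithSpectrum.mp hP.1
  let g : ℝ → ℝ := fun x => (x - 1) / (x + 1)
  have hg {x : ℝ} (hx : 0 < x) : g x ∈ Set.Ioo (-1) 1 := by
    constructor
    · rw [lt_div_iff₀ (by positivity)]; linarith
    · rw [div_lt_one (by positivity)]; linarith
  have hg_inv {x : ℝ} (hx : 0 < x) : g x⁻¹ = -g x := by
    simp only [g]; field_simp; ring
  have hg_cayley {x : ℝ} (hx : 0 < x) : cayley (g x) = x := by
    simp only [g, cayley]; field_simp; ring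
  refine ⟨cfc g P, ⟨cfc_mem_hermitianWithSpectrum (fun _ => hg) hP', ?_⟩, ?_⟩
  · rw [← cfc_conj_J hP.1.1, (mem_posDefSymplectic_iff hP.1).mp hP, ← cfc_inv_eq_inv hP.1,
      cfc_cfc hP.1.1, cfc_congr fun x hx => hg_inv (hP'.2 hx), cfc_neg]
  · rw [cfc_cfc hP.1.1, cfc_congr fun x hx => hg_cayley (hP'.2 hx),
      cfc_id' ℝ P hP.1.1.isSelfAdjoint]

/-- `4⁻¹ tr |log P|`, which is `F S` when `P = Sᵀ S` for a symplectic matrix `S`. -/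
noncomputable def logCost {m : Type*} [Fintype m] [DecidableEq m] (P : Matrix m m ℝ) : ℝ :=
  4⁻¹ * trace (cfc (fun x => |Real.log x|) P)

theorem exists_posDefSymplectic_le {P Q : Matrix (l ⊕ l) (l ⊕ l) ℝ} (hP : P ∈ posDefSymplectic l)
    (hQ : Q ∈ posDefSymplectic l) {a b : ℝ} (ha : 0 ≤ a) (hb : 0 ≤ b) (hab : a + b = 1) :
    ∃ R ∈ posDefSymplectic l, R ≤ a • P + b • Q ∧ logCost R ≤ a * logCost P + b * logCost Q := by
  obtain ⟨K, hK, rfl⟩ := exists_cfc_cayley_eq hP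
  obtain ⟨L, hL, rfl⟩ := exists_cfc_cayley_eq hQ
  have hM := convex_cayleyDomain hK hL ha hb hab
  have hIio {t : Set ℝ} (ht : t ⊆ Set.Ioo (-1) 1) : t ⊆ Set.Iio 1 :=
    ht.trans Set.Ioo_subset_Iio_self
  refine ⟨cfc cayley (a • K + b • L), cfc_cayley_mem hM,
    convexOn_cfc_cayley.2 (hK.1.imp_right hIio) (hL.1.imp_right hIio) ha hb hab, ?_⟩
  have h := (convexOn_re_trace_cfc (𝕜 := ℝ) convexOn_abs_log_cayley).2 hK.1 hL.1 ha hb hab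
  simp only [RCLike.re_to_real, smul_eq_mul] at h
  rw [logCost, logCost, logCost, cfc_cfc hM.1.1, cfc_cfc hK.1.1, cfc_cfc hL.1.1]
  linarith

end SymplecticGroup

section GeometricMean

variable {𝕜 m : Type*} [RCLike 𝕜] [Fintype m] [DecidableEq m] {A B X : Matrix m m 𝕜}

/-- The geometric mean `A # B` of positive definite matrices, the unique positive semidefinite
solution `X` of the Riccati equation `X * A⁻¹ * X = B`. -/
noncomputable def geomMean (A B : Matrix m m 𝕜) : Matrix m m 𝕜 :=
  CFC.sqrt A * CFC.sqrt ((CFC.sqrt A)⁻¹ * B * (CFC.sqrt A)⁻¹) * CFC.sqrt A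

theorem posDef_sqrt (hA : A.PosDef) : (CFC.sqrt A).PosDef :=
  hA.isStrictlyPositive.sqrt.posDef

theorem inv_eq_inv_sqrt_mul_inv_sqrt (hA : A.PosSemidef) :
    A⁻¹ = (CFC.sqrt A)⁻¹ * (CFC.sqrt A)⁻¹ := by
  rw [← Matrix.mul_inv_rev, CFC.sqrt_mul_sqrt_self A hA.nonneg]

theorem geomMean_nonneg (A B : Matrix m m 𝕜) : 0 ≤ geomMean A B :=
  (CFC.sqrt_nonneg A).isSelfAdjoint.conjugate_nonneg (CFC.sqrt_nonneg _)

theorem geomMean_mul_inv_mul_geomMean (hA : A.PosDef) (hB : B.PosSemidef) :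
    geomMean A B * A⁻¹ * geomMean A B = B := by
  have hS := posDef_sqrt hA
  have hdet := (isUnit_iff_isUnit_det _).mp hS.isUnit
  have hZ : 0 ≤ (CFC.sqrt A)⁻¹ * B * (CFC.sqrt A)⁻¹ :=
    hS.1.inv.isSelfAdjoint.conjugate_nonneg hB.nonneg
  rw [inv_eq_inv_sqrt_mul_inv_sqrt hA.posSemidef, geomMean]
  generalize CFC.sqrt A = S at *
  set Z := S⁻¹ * B * S⁻¹
  calc S * CFC.sqrt Z * S * (S⁻¹ * S⁻¹) * (S * CFC.sqrt Z * S)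
    _ = S * (CFC.sqrt Z * (S * S⁻¹) * (S⁻¹ * S) * CFC.sqrt Z) * S := by simp only [mul_assoc]
    _ = S * (S⁻¹ * B * S⁻¹) * S := by
        rw [mul_nonsing_inv _ hdet, nonsing_inv_mul _ hdet, mul_one, mul_one,
          CFC.sqrt_mul_sqrt_self _ hZ]
    _ = S * S⁻¹ * B * (S⁻¹ * S) := by simp only [mul_assoc]
    _ = B := by rw [mul_nonsing_inv _ hdet, nonsing_inv_mul _ hdet, one_mul, mul_one]

theorem eq_geomMean (hA : A.PosDef) (hX : X.PosSemidef) (hXB : X * A⁻¹ * X = B) :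
    X = geomMean A B := by
  have hS := posDef_sqrt hA
  have hdet := (isUnit_iff_isUnit_det _).mp hS.isUnit
  have hY : CFC.sqrt ((CFC.sqrt A)⁻¹ * B * (CFC.sqrt A)⁻¹) =
      (CFC.sqrt A)⁻¹ * X * (CFC.sqrt A)⁻¹ := by
    refine CFC.sqrt_unique ?_ (hS.1.inv.isSelfAdjoint.conjugate_nonneg hX.nonneg)
    rw [← hXB, inv_eq_inv_sqrt_mul_inv_sqrt hA.posSemidef]
    simp only [mul_assoc]
  rw [geomMean, hY]
  calc X = CFC.sqrt A * (CFC.sqrt A)⁻¹ * X * ((CFC.sqrt A)⁻¹ * CFC.sqrt A) := by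
        rw [mul_nonsing_inv _ hdet, nonsing_inv_mul _ hdet, one_mul, mul_one]
    _ = _ := by simp only [mul_assoc]

theorem sqrt_eq_cfc_real_sqrt (hX : 0 ≤ X) : CFC.sqrt X = cfc Real.sqrt X := by
  rw [CFC.sqrt_eq_real_sqrt X, cfcₙ_eq_cfc]

theorem sqrt_le_one (hX : 0 ≤ X) (hX1 : X ≤ 1) : CFC.sqrt X ≤ 1 := by
  rw [sqrt_eq_cfc_real_sqrt hX]
  exact cfc_le_one _ X fun x hx => Real.sqrt_le_one.mpr
    ((CFC.le_one_iff (R := ℝ) X hX.isSelfAdjoint).mp hX1 x hx)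

theorem geomMean_le_left (hA : A.PosDef) (hB : B.PosSemidef) (hBA : B ≤ A) : geomMean A B ≤ A := by
  have hS := posDef_sqrt hA
  have hdet := (isUnit_iff_isUnit_det _).mp hS.isUnit
  have hZ : 0 ≤ (CFC.sqrt A)⁻¹ * B * (CFC.sqrt A)⁻¹ :=
    hS.1.inv.isSelfAdjoint.conjugate_nonneg hB.nonneg
  have hA_sqrt := CFC.sqrt_mul_sqrt_self A hA.posSemidef.nonneg
  have hZ_le : (CFC.sqrt A)⁻¹ * B * (CFC.sqrt A)⁻¹ ≤ 1 :=
    calc (CFC.sqrt A)⁻¹ * B * (CFC.sqrt A)⁻¹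
      _ ≤ (CFC.sqrt A)⁻¹ * A * (CFC.sqrt A)⁻¹ :=
        hS.1.inv.isSelfAdjoint.conjugate_le_conjugate hBA
      _ = ((CFC.sqrt A)⁻¹ * CFC.sqrt A) * (CFC.sqrt A * (CFC.sqrt A)⁻¹) := by
        nth_rw 2 [← hA_sqrt]; simp only [mul_assoc]
      _ = 1 := by rw [mul_nonsing_inv _ hdet, nonsing_inv_mul _ hdet, one_mul]
  calc geomMean A B
    _ ≤ CFC.sqrt A * 1 * CFC.sqrt A :=
      hS.1.isSelfAdjoint.conjugate_le_conjugate (sqrt_le_one hZ hZ_le)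
    _ = A := by rw [mul_one, hA_sqrt]

theorem posDef_geomMean (hA : A.PosDef) (hB : B.PosDef) : (geomMean A B).PosDef := by
  refine (geomMean_nonneg A B).posSemidef.posDef_iff_isUnit.mpr ?_
  have h := hB.isUnit
  rw [← geomMean_mul_inv_mul_geomMean hA hB.posSemidef] at h
  exact isUnit_of_mul_isUnit_right h

end GeometricMean

section SymplecticMean

variable {l : Type*} [Fintype l] [DecidableEq l] {A P : Matrix (l ⊕ l) (l ⊕ l) ℝ}

theorem transpose_mul_self_mem_posDefSymplectic {S : Matrix (l ⊕ l) (l ⊕ l) ℝ}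
    (hS : S ∈ symplecticGroup l ℝ) : Sᵀ * S ∈ posDefSymplectic l :=
  ⟨PosDef.conjTranspose_mul_self S (mulVec_injective_of_isUnit
    ((isUnit_iff_isUnit_det S).mpr (SymplecticGroup.symplectic_det hS))),
    mul_mem (SymplecticGroup.transpose_mem hS) hS⟩

theorem sqrt_mem_posDefSymplectic (hP : P ∈ posDefSymplectic l) :
    CFC.sqrt P ∈ posDefSymplectic l := by
  have hinv := (mem_posDefSymplectic_iff hP.1).mp hP
  rw [mem_posDefSymplectic_iff (posDef_sqrt hP.1), hP.1.posSemidef.inv_sqrt,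
    sqrt_eq_cfc_real_sqrt hP.1.posSemidef.nonneg, sqrt_eq_cfc_real_sqrt hP.1.inv.posSemidef.nonneg,
    ← hinv, cfc_conj_J hP.1.1]

theorem posDef_conj_J (hA : A.PosDef) : ((J l ℝ)ᵀ * A * J l ℝ).PosDef :=
  hA.conjTranspose_mul_mul_same
    (mulVec_injective_of_isUnit ((isUnit_iff_isUnit_det _).mpr (isUnit_det_J l ℝ)))

theorem conj_J_conj_J {R : Type*} [CommRing R] (A : Matrix (l ⊕ l) (l ⊕ l) R) :
    (J l R)ᵀ * ((J l R)ᵀ * A * J l R) * J l R = A := by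
  rw [mul_assoc, mul_assoc (_ * A), J_squared, ← mul_assoc, ← mul_assoc, J_transpose, neg_mul_neg,
    J_squared, neg_one_mul, mul_neg_one, neg_neg]

theorem geomMean_mem_posDefSymplectic (hA : A.PosDef) :
    geomMean A ((J l ℝ)ᵀ * A⁻¹ * J l ℝ) ∈ posDefSymplectic l := by
  set B := (J l ℝ)ᵀ * A⁻¹ * J l ℝ with hB_def
  set P := geomMean A B
  have hB : B.PosDef := posDef_conj_J hA.inv
  have hP : P.PosDef := posDef_geomMean hA hB
  have hdet := (isUnit_iff_isUnit_det _).mp hP.isUnit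
  have hPB : P * A⁻¹ * P = B := geomMean_mul_inv_mul_geomMean hA hB.posSemidef
  have hinv_eq : (J l ℝ)ᵀ * P⁻¹ * J l ℝ = P := by
    refine eq_geomMean hA (posDef_conj_J hP.inv).posSemidef ?_
    calc (J l ℝ)ᵀ * P⁻¹ * J l ℝ * A⁻¹ * ((J l ℝ)ᵀ * P⁻¹ * J l ℝ)
      _ = (J l ℝ)ᵀ * P⁻¹ * B * P⁻¹ * J l ℝ := by simp [hB_def, mul_assoc]
      _ = (J l ℝ)ᵀ * ((P⁻¹ * P) * A⁻¹ * (P * P⁻¹)) * J l ℝ := by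
        rw [← hPB]; simp only [mul_assoc]
      _ = B := by rw [mul_nonsing_inv _ hdet, nonsing_inv_mul _ hdet, one_mul, mul_one]
  rw [mem_posDefSymplectic_iff hP]
  conv_lhs => rw [← hinv_eq]
  rw [conj_J_conj_J]

end SymplecticMean

section SingularValues

theorem eq_of_antitone_of_map_eq {α : Type*} [PartialOrder α] {n : ℕ} {f g : Fin n → α}
    (hf : Antitone f) (hg : Antitone g)
    (h : Multiset.map f Finset.univ.val = Multiset.map g Finset.univ.val) : f = g := by
  rw [Fin.univ_val_map, Fin.univ_val_map, Multiset.coe_eq_coe] at h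
  exact List.ofFn_injective (h.eq_of_pairwise' hf.sortedGE_ofFn.pairwise hg.sortedGE_ofFn.pairwise)

theorem sum_castLE_eq_half_sum_abs {N n : ℕ} (hN : N = n + n) {g : Fin N → ℝ} (hg : Antitone g)
    (hrev : ∀ i, g i.rev = -g i) :
    ∑ i : Fin n, g (Fin.castLE (hN ▸ n.le_add_right n) i) = 2⁻¹ * ∑ i, |g i| := by
  subst hN
  have hnonneg (i : Fin n) : 0 ≤ g (Fin.castAdd n i) := by
    have hle : Fin.castAdd n i ≤ (Fin.castAdd n i).rev := by
      rw [Fin.le_def, Fin.val_rev, Fin.val_castAdd]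
      omega
    linarith [hg hle, hrev (Fin.castAdd n i)]
  have hupper : ∑ i : Fin n, |g (Fin.natAdd n i)| = ∑ i : Fin n, |g (Fin.castAdd n i)| := by
    rw [← Equiv.sum_comp Fin.revPerm]
    refine Finset.sum_congr rfl fun i _ => ?_
    have hrev_castAdd : (Fin.castAdd n i).rev = Fin.natAdd n i.rev := by
      ext
      simp only [Fin.val_rev, Fin.val_castAdd, Fin.val_natAdd]
      omega
    rw [Fin.revPerm_apply, ← hrev_castAdd, hrev, abs_neg]
  conv_rhs => rw [Fin.sum_univ_add, hupper, ← two_mul, inv_mul_cancel_left₀ two_ne_zero]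
  exact Finset.sum_congr rfl fun i _ => (abs_of_nonneg (hnonneg i)).symm

variable {𝕜 m : Type*} [RCLike 𝕜] [Fintype m] [DecidableEq m] {A : Matrix m m 𝕜}

theorem singularValues_toEuclideanLin (A : Matrix m m 𝕜) (i : Fin (Fintype.card m)) :
    (toEuclideanLin A).singularValues i =
      √((isHermitian_conjTranspose_mul_self A).eigenvalues₀ i) := by
  have hadjoint : (toEuclideanLin A).adjoint ∘ₗ toEuclideanLin A = toEuclideanLin (Aᴴ * A) := by
    rw [← toEuclideanLin_conjTranspose_eq_adjoint, toLpLin_mul_same]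
  rw [LinearMap.singularValues_fin (toEuclideanLin A) (finrank_euclideanSpace (𝕜 := 𝕜))]
  simp only [hadjoint, IsHermitian.eigenvalues₀]

theorem eigenvalues₀_mem_spectrum_real (hA : A.IsHermitian) (i : Fin (Fintype.card m)) :
    hA.eigenvalues₀ i ∈ spectrum ℝ A := by
  simpa [IsHermitian.eigenvalues] using
    hA.eigenvalues_mem_spectrum_real (Fintype.equivOfCardEq (Fintype.card_fin _) i)

theorem eigenvalues₀_pos (hA : A.PosDef) (i : Fin (Fintype.card m)) : 0 < hA.1.eigenvalues₀ i :=
  (posDef_iff_mem_hermitianWithSpectrum.mp hA).2 (eigenvalues₀_mem_spectrum_real hA.1 i)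

theorem roots_charpoly_cfc (hA : A.IsHermitian) (f : ℝ → ℝ) :
    (cfc f A).charpoly.roots =
      Multiset.map (RCLike.ofReal ∘ f ∘ hA.eigenvalues₀) Finset.univ.val := by
  rw [hA.charpoly_cfc_eq, Polynomial.roots_prod _ _
    (Finset.prod_ne_zero_iff.mpr fun _ _ => Polynomial.X_sub_C_ne_zero _)]
  simp only [Polynomial.roots_X_sub_C, Multiset.bind_singleton]
  rw [← Multiset.map_univ_val_equiv (Fintype.equivOfCardEq (Fintype.card_fin (Fintype.card m))),
    Multiset.map_map]
  simp [IsHermitian.eigenvalues, Function.comp_def]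

theorem eigenvalues₀_rev (hA : A.IsHermitian) {f : ℝ → ℝ} (hf : AntitoneOn f (spectrum ℝ A))
    (hcharpoly : (cfc f A).charpoly = A.charpoly) (i : Fin (Fintype.card m)) :
    hA.eigenvalues₀ i.rev = f (hA.eigenvalues₀ i) := by
  have hanti : Antitone fun j : Fin (Fintype.card m) => f (hA.eigenvalues₀ j.rev) := fun j k hjk =>
    hf (eigenvalues₀_mem_spectrum_real hA _) (eigenvalues₀_mem_spectrum_real hA _)
      (hA.eigenvalues₀_antitone (Fin.rev_le_rev.mpr hjk))
  have hroots : Multiset.map (f ∘ hA.eigenvalues₀) Finset.univ.val =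
      Multiset.map hA.eigenvalues₀ Finset.univ.val := by
    refine Multiset.map_injective (RCLike.ofReal_injective (K := 𝕜)) ?_
    rw [Multiset.map_map, Multiset.map_map, ← roots_charpoly_cfc, hcharpoly,
      hA.roots_charpoly_eq_eigenvalues₀]
  have hrev := eq_of_antitone_of_map_eq (f := (f ∘ hA.eigenvalues₀) ∘ Fin.revPerm) hanti
    hA.eigenvalues₀_antitone (by rw [← Multiset.map_map, Multiset.map_univ_val_equiv, hroots])
  simpa using (congrFun hrev i.rev).symm

variable {l : Type*} [Fintype l] [DecidableEq l]

theorem log_eigenvalues₀_rev {P : Matrix (l ⊕ l) (l ⊕ l) ℝ}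
    (hP : P ∈ posDefSymplectic l) (i : Fin (Fintype.card (l ⊕ l))) :
    Real.log (hP.1.1.eigenvalues₀ i.rev) = -Real.log (hP.1.1.eigenvalues₀ i) := by
  have hspec := (posDef_iff_mem_hermitianWithSpectrum.mp hP.1).2
  have hcharpoly : (cfc (fun x : ℝ => x⁻¹) P).charpoly = P.charpoly := by
    rw [cfc_inv_eq_inv hP.1, ← (mem_posDefSymplectic_iff hP.1).mp hP, charpoly_mul_comm,
      ← mul_assoc, J_transpose, mul_neg, J_squared, neg_neg, one_mul]
  rw [eigenvalues₀_rev hP.1.1 (fun x hx y _ hxy => inv_anti₀ (hspec hx) hxy) hcharpoly,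
    Real.log_inv]

theorem F_eq_logCost {n : ℕ} {S : Mat n} (hS : S ∈ symplecticGroup (Fin n) ℝ) :
    F S = logCost (Sᵀ * S) := by
  have hP := transpose_mul_self_mem_posDefSymplectic hS
  have hcard : Fintype.card (Fin n ⊕ Fin n) = n + n := by simp
  have hlog_anti : Antitone fun i => Real.log (hP.1.1.eigenvalues₀ i) := fun i j hij =>
    Real.log_le_log (eigenvalues₀_pos hP.1 j) (hP.1.1.eigenvalues₀_antitone hij)
  have htrace : trace (cfc (fun x => |Real.log x|) (Sᵀ * S)) =
      ∑ i, |Real.log (hP.1.1.eigenvalues₀ i)| := by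
    rw [trace_cfc_eq_sum_eigenvalues hP.1.1]
    exact Equiv.sum_comp _ fun i => |Real.log (hP.1.1.eigenvalues₀ i)|
  calc F S = ∑ i : Fin n, 2⁻¹ * Real.log (hP.1.1.eigenvalues₀
          (Fin.castLE (hcard ▸ n.le_add_right n) i)) := by
        rw [F, Finset.sum_range]
        refine Finset.sum_congr rfl fun i _ => ?_
        rw [← Fin.val_castLE (hcard ▸ n.le_add_right n) i, singularValues_toEuclideanLin]
        exact (Real.log_sqrt (eigenvalues₀_pos hP.1 _).le).trans (div_eq_inv_mul _ _)
    _ = 2⁻¹ * (2⁻¹ * ∑ i, |Real.log (hP.1.1.eigenvalues₀ i)|) := by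
        rw [← Finset.mul_sum, sum_castLE_eq_half_sum_abs hcard hlog_anti (log_eigenvalues₀_rev hP)]
    _ = logCost (Sᵀ * S) := by rw [logCost, htrace]; ring

end SingularValues

section CovarianceMatrices

theorem posDef_of_posSemidef_fromBlocks {𝕜 m₁ m₂ : Type*} [RCLike 𝕜] [Finite m₁] [Fintype m₂]
    {A : Matrix m₁ m₁ 𝕜} {B : Matrix m₁ m₂ 𝕜} {C : Matrix m₂ m₁ 𝕜} {D : Matrix m₂ m₂ 𝕜}
    (h : (fromBlocks A B C D).PosSemidef) (hB : Function.Injective B.mulVec) : D.PosDef := by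
  have := Fintype.ofFinite m₁
  have hD : D.PosSemidef := h.submatrix Sum.inr
  refine .of_dotProduct_mulVec_pos hD.1 fun v hv => (hD.dotProduct_mulVec_nonneg v).lt_of_ne' ?_
  intro hzero
  have hker : fromBlocks A B C D *ᵥ Sum.elim 0 v = 0 := by
    refine (h.dotProduct_mulVec_zero_iff _).mp ?_
    rw [fromBlocks_mulVec, Function.star_sumElim, sumElim_dotProduct_sumElim]
    simpa using hzero
  have hBv : B *ᵥ v = 0 := by
    ext i
    simpa [fromBlocks_mulVec] using congrFun hker (Sum.inl i)
  exact hv (hB (hBv.trans (mulVec_zero B).symm))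

theorem re_dotProduct_mulVec_eq_fromBlocks {m : Type*} [Fintype m] (A B : Matrix m m ℝ)
    (x : m ⊕ m → ℝ) :
    (star (fun i => (⟨x (Sum.inl i), x (Sum.inr i)⟩ : ℂ)) ⬝ᵥ
      (A.map Complex.ofReal - Complex.I • B.map Complex.ofReal) *ᵥ
        fun i => ⟨x (Sum.inl i), x (Sum.inr i)⟩).re = x ⬝ᵥ fromBlocks A B (-B) A *ᵥ x := by
  simp only [dotProduct, mulVec, Fintype.sum_sum_type, fromBlocks_apply₁₁, fromBlocks_apply₁₂,
    fromBlocks_apply₂₁, fromBlocks_apply₂₂, mul_add, Finset.mul_sum, Complex.re_sum,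
    ← Finset.sum_add_distrib]
  refine Finset.sum_congr rfl fun i _ => Finset.sum_congr rfl fun j _ => ?_
  simp only [Pi.star_apply, RCLike.star_def, Matrix.sub_apply, map_apply, Matrix.smul_apply,
    smul_eq_mul, Complex.mul_re, Complex.conj_re, Complex.sub_re, Complex.ofReal_re, Complex.I_re,
    zero_mul, Complex.I_im, Complex.ofReal_im, mul_zero, sub_self, sub_zero, Complex.sub_im,
    Complex.mul_im, one_mul, zero_add, zero_sub, neg_mul, sub_neg_eq_add, Complex.conj_im,
    Matrix.neg_apply, mul_neg]
  ring

theorem posSemidef_fromBlocks_of_complex {m : Type*} [Finite m] {A B : Matrix m m ℝ}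
    (h : (A.map Complex.ofReal - Complex.I • B.map Complex.ofReal).PosSemidef) :
    (fromBlocks A B (-B) A).PosSemidef := by
  have := Fintype.ofFinite m
  have hentry (i j : m) := congrFun (congrFun h.1.eq i) j
  have hA : Aᵀ = A := by
    ext i j; simpa using congrArg Complex.re (hentry i j)
  have hB : Bᵀ = -B := by
    ext i j; simpa [neg_eq_iff_eq_neg] using congrArg Complex.im (hentry i j)
  refine .of_dotProduct_mulVec_nonneg ?_ fun x => ?_
  · simp [IsHermitian, conjTranspose_eq_transpose_of_trivial, fromBlocks_transpose, hA, hB]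
  · have hz := (Complex.le_def.mp (h.dotProduct_mulVec_nonneg
      fun i => ⟨x (Sum.inl i), x (Sum.inr i)⟩)).1
    rwa [re_dotProduct_mulVec_eq_fromBlocks] at hz

variable {n : ℕ} {Γ : Mat n}

theorem posSemidef_fromBlocks_J (hΓ : Γ ∈ covarianceMatrices n) :
    (fromBlocks Γ (J (Fin n) ℝ)ᵀ (J (Fin n) ℝ) Γ).PosSemidef := by
  have hJ : symplecticForm n = (J (Fin n) ℝ)ᵀ := by
    simp [symplecticForm, J, fromBlocks_transpose]
  simpa [hJ] using posSemidef_fromBlocks_of_complex hΓ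

theorem posDef_of_mem_covarianceMatrices (hΓ : Γ ∈ covarianceMatrices n) : Γ.PosDef :=
  posDef_of_posSemidef_fromBlocks (posSemidef_fromBlocks_J hΓ) <| mulVec_injective_of_isUnit <|
    (isUnit_iff_isUnit_det _).mpr <| by rw [det_transpose]; exact isUnit_det_J (Fin n) ℝ

theorem conj_J_inv_le (hΓ : Γ ∈ covarianceMatrices n) :
    (J (Fin n) ℝ)ᵀ * Γ⁻¹ * J (Fin n) ℝ ≤ Γ := by
  have hpos := posDef_of_mem_covarianceMatrices hΓ
  have := hpos.isUnit.invertible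
  have hSchur := PosDef.fromBlocks₂₂ Γ (J (Fin n) ℝ)ᵀ hpos
  rw [conjTranspose_eq_transpose_of_trivial, transpose_transpose] at hSchur
  exact hSchur.mp (posSemidef_fromBlocks_J hΓ)

theorem convex_covarianceMatrices (n : ℕ) : Convex ℝ (covarianceMatrices n) := by
  intro Γ hΓ Γ' hΓ' a b ha hb hab
  have hmap : (a • Γ + b • Γ').map Complex.ofReal =
      a • Γ.map Complex.ofReal + b • Γ'.map Complex.ofReal := by
    ext i j; simp
  have h := (PosSemidef.smul hΓ ha).add (PosSemidef.smul hΓ' hb)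
  rwa [smul_sub, smul_sub, sub_add_sub_comm, Convex.combo_self hab, ← hmap] at h

theorem exists_posDefSymplectic_le_self (hΓ : Γ ∈ covarianceMatrices n) :
    ∃ P ∈ posDefSymplectic (Fin n), P ≤ Γ :=
  have hpos := posDef_of_mem_covarianceMatrices hΓ
  ⟨_, geomMean_mem_posDefSymplectic hpos,
    geomMean_le_left hpos (posDef_conj_J hpos.inv).posSemidef (conj_J_inv_le hΓ)⟩

end CovarianceMatrices

section SqueezingMeasure

variable {n : ℕ}

theorem costs_eq_image (Γ : Mat n) :
    costs Γ = logCost '' {P ∈ posDefSymplectic (Fin n) | P ≤ Γ} := by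
  ext x
  constructor
  · rintro ⟨S, hS, hle, rfl⟩
    exact ⟨Sᵀ * S, ⟨transpose_mul_self_mem_posDefSymplectic hS, hle⟩, (F_eq_logCost hS).symm⟩
  · rintro ⟨P, ⟨hP, hle⟩, rfl⟩
    have hS := sqrt_mem_posDefSymplectic hP
    have hmul : (CFC.sqrt P)ᵀ * CFC.sqrt P = P := by
      rw [(isHermitian_iff_isSymm.mp hS.1.1).eq, CFC.sqrt_mul_sqrt_self P hP.1.posSemidef.nonneg]
    exact ⟨CFC.sqrt P, hS.2, by rwa [hmul], by rw [F_eq_logCost hS.2, hmul]⟩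

theorem logCost_nonneg {m : Type*} [Fintype m] [DecidableEq m] {P : Matrix m m ℝ}
    (hP : P.IsHermitian) : 0 ≤ logCost P := by
  rw [logCost, trace_cfc_eq_sum_eigenvalues hP]
  exact mul_nonneg (by norm_num) (Finset.sum_nonneg fun i _ => abs_nonneg _)

theorem convexOn_sInf {E : Type*} [AddCommGroup E] [Module ℝ E] {s : Set E} {C : E → Set ℝ}
    (hs : Convex ℝ s) (hne : ∀ x ∈ s, (C x).Nonempty) (hbdd : ∀ x ∈ s, BddBelow (C x))
    (hC : ∀ ⦃x⦄, x ∈ s → ∀ ⦃y⦄, y ∈ s → ∀ ⦃a b : ℝ⦄, 0 ≤ a → 0 ≤ b → a + b = 1 →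
      ∀ u ∈ C x, ∀ v ∈ C y, ∃ w ∈ C (a • x + b • y), w ≤ a * u + b * v) :
    ConvexOn ℝ s fun x => sInf (C x) := by
  refine ⟨hs, fun x hx y hy a b ha hb hab => le_of_forall_pos_le_add fun ε hε => ?_⟩
  obtain ⟨u, hu, hu_lt⟩ := exists_lt_of_csInf_lt (hne x hx) (lt_add_of_pos_right _ hε)
  obtain ⟨v, hv, hv_lt⟩ := exists_lt_of_csInf_lt (hne y hy) (lt_add_of_pos_right _ hε)
  obtain ⟨w, hw, hw_le⟩ := hC hx hy ha hb hab u hu v hv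
  calc sInf (C (a • x + b • y)) ≤ w := csInf_le (hbdd _ (hs hx hy ha hb hab)) hw
    _ ≤ a * u + b * v := hw_le
    _ ≤ a * (sInf (C x) + ε) + b * (sInf (C y) + ε) := by gcongr
    _ = a • sInf (C x) + b • sInf (C y) + ε := by
      rw [smul_eq_mul, smul_eq_mul]; linear_combination ε * hab

theorem costs_nonempty {Γ : Mat n} (hΓ : Γ ∈ covarianceMatrices n) : (costs Γ).Nonempty := by
  rw [costs_eq_image]
  exact (exists_posDefSymplectic_le_self hΓ).imp' _ fun _ hP => Set.mem_image_of_mem _ hP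

theorem bddBelow_costs (Γ : Mat n) : BddBelow (costs Γ) := by
  rw [costs_eq_image]
  exact ⟨0, by rintro _ ⟨P, hP, rfl⟩; exact logCost_nonneg hP.1.1.1⟩

theorem exists_mem_costs_le {Γ Γ' : Mat n} {a b u v : ℝ} (ha : 0 ≤ a) (hb : 0 ≤ b)
    (hab : a + b = 1) (hu : u ∈ costs Γ) (hv : v ∈ costs Γ') :
    ∃ w ∈ costs (a • Γ + b • Γ'), w ≤ a * u + b * v := by
  rw [costs_eq_image] at hu hv ⊢
  obtain ⟨P, ⟨hP, hPΓ⟩, rfl⟩ := hu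
  obtain ⟨Q, ⟨hQ, hQΓ'⟩, rfl⟩ := hv
  obtain ⟨R, hR, hle, hcost⟩ := exists_posDefSymplectic_le hP hQ ha hb hab
  exact ⟨_, Set.mem_image_of_mem _ ⟨hR, hle.trans (by gcongr)⟩, hcost⟩

end SqueezingMeasure

end Squeezing

theorem mainTheorem4 (n : ℕ) :
    (∀ Γ ∈ Squeezing.covarianceMatrices n,
      IsGLB (Squeezing.costs Γ) (Squeezing.G Γ)) ∧
    ConvexOn ℝ (Squeezing.covarianceMatrices n) (Squeezing.G : Squeezing.Mat n → ℝ) :=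
  ⟨fun Γ hΓ => isGLB_csInf (Squeezing.costs_nonempty hΓ) (Squeezing.bddBelow_costs Γ),
    Squeezing.convexOn_sInf (Squeezing.convex_covarianceMatrices n)
      (fun _ => Squeezing.costs_nonempty) (fun Γ _ => Squeezing.bddBelow_costs Γ)
      fun _ _ _ _ _ _ ha hb hab _ hu _ hv => Squeezing.exists_mem_costs_le ha hb hab hu hv⟩
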